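/- Let $k$ be an algebraically closed field of characteristic $p>0$, and let $i\colon X\hookrightarrow\mathbb{P}^n_k$ be a closed immersion, where $X$ is a smooth (integral) projective variety over $k$. Put $\mathcal{O}_X(m)=i^*\mathcal{O}_{\mathbb{P}^n}(m)$ and $G(m)=G\otimes_{\mathcal{O}_X}\mathcal{O}_X(m)$ for every sheaf of $\mathcal{O}_X$-modules $G$ and every $m\in\mathbb{Z}$. Call a vector bundle (locally free sheaf of finite rank) $G$ on $X$ an \emph{ACM bundle} if $H^j(X,G(m))=0$ for all integers $j$ with $0<j<\dim X$ and all $m\in\mathbb{Z}$. Let $F\colon X\to X$ be the absolute Frobenius morphism, i.e. the identity on the underlying topological space and $a\mapsto a^p$ on sections of $\mathcal{O}_X$. If $E$ is an ACM bundle on $X$, then $F_*(E)$ is an ACM bundle on $X$ (in particular, $F_*(E)$ is locally free of finite rank). -/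

import Mathlib

universe u

open CategoryTheory AlgebraicGeometry TopologicalSpace Opposite

noncomputable section

namespace PushACM

/-! ### Serre's twisting sheaves on `Proj` -/

section Twist

variable {A σ : Type u} [CommRing A] [SetLike σ A] [AddSubgroupClass σ A]
  (𝒜 : ℕ → σ) [GradedRing 𝒜] (m : ℤ)

/-- The localization `A_𝔭` of the whole ring `A` at a homogeneous prime `𝔭`. -/
abbrev LocAt (x : ProjectiveSpectrum 𝒜) : Type u :=
  Localization x.asHomogeneousIdeal.toIdeal.primeCompl

/-- The fraction `r / s` in `A_𝔭`. -/
abbrev fracAt (x : ProjectiveSpectrum 𝒜) (r s : A)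
    (hs : s ∈ x.asHomogeneousIdeal.toIdeal.primeCompl) : LocAt 𝒜 x :=
  Localization.mk r ⟨s, hs⟩

lemma fracAt_add (x : ProjectiveSpectrum 𝒜) (a b c d : A) (hb hd) :
    fracAt 𝒜 x a b hb + fracAt 𝒜 x c d hd =
      fracAt 𝒜 x (b * c + d * a) (b * d) (mul_mem hb hd) :=
  Localization.add_mk _ _ _ _

lemma fracAt_mul (x : ProjectiveSpectrum 𝒜) (a b c d : A) (hb hd) :
    fracAt 𝒜 x a b hb * fracAt 𝒜 x c d hd = fracAt 𝒜 x (a * c) (b * d) (mul_mem hb hd) :=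
  Localization.mk_mul _ _ _ _

/-- `f` is given on `U` by one fraction `r / s` with `r`, `s` homogeneous and
`deg r - deg s = m`. -/
def IsTwistedFraction {U : Opens (ProjectiveSpectrum.top 𝒜)} (f : ∀ x : U, LocAt 𝒜 x.1) :
    Prop :=
  ∃ (d e : ℕ) (r : 𝒜 d) (s : 𝒜 e), (d : ℤ) = e + m ∧
    ∀ x : U, ∃ hs, f x = fracAt 𝒜 x.1 r.1 s.1 hs

/-- Being a fraction of degree `m` is stable under restriction to smaller opens. -/
def isTwistedFractionPrelocal :
    TopCat.PrelocalPredicate (fun x : ProjectiveSpectrum.top 𝒜 => LocAt 𝒜 x) where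
  pred f := IsTwistedFraction 𝒜 m f
  res := by
    rintro V U i f ⟨d, e, r, s, h, w⟩
    exact ⟨d, e, r, s, h, fun x => w (i x)⟩

/-- Being locally a fraction of degree `m`. -/
def isLocallyTwistedFraction :
    TopCat.LocalPredicate (fun x : ProjectiveSpectrum.top 𝒜 => LocAt 𝒜 x) :=
  (isTwistedFractionPrelocal 𝒜 m).sheafify

lemma exists_homogeneous_notMem (x : ProjectiveSpectrum 𝒜) :
    ∃ (e : ℕ) (s : 𝒜 e), 0 ≤ e + m ∧ s.1 ∈ x.asHomogeneousIdeal.toIdeal.primeCompl := by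
  classical
  obtain ⟨f, d, hf, hd, hx⟩ : ∃ (f : A) (d : ℕ) (_ : f ∈ 𝒜 d) (_ : 0 < d),
      f ∉ x.asHomogeneousIdeal.toIdeal := by
    by_contra! H
    refine x.not_irrelevant_le fun z hz => ?_
    rw [← DirectSum.sum_support_decompose 𝒜 z]
    refine x.1.toIdeal.sum_mem fun k hk => H _ k (SetLike.coe_mem _) ?_
    by_contra h0
    obtain rfl : k = 0 := by omega
    have h1 := (HomogeneousIdeal.mem_irrelevant_iff _ _).mp hz
    rw [GradedRing.proj_apply] at h1
    simp at hk
    exact hk (Subtype.ext h1)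
  refine ⟨m.natAbs • d, ⟨f ^ m.natAbs, SetLike.pow_mem_graded _ hf⟩, ?_,
    Submonoid.pow_mem _ hx _⟩
  have : m.natAbs ≤ m.natAbs * d := Nat.le_mul_of_pos_right _ hd
  simp only [smul_eq_mul]
  omega

/-- The sections of `𝒪(m)` over `U`: functions `f` on `U` with `f(𝔭) ∈ A_𝔭` which are locally
fractions of degree `m`. -/
def twistSections (U : (Opens (ProjectiveSpectrum.top 𝒜))ᵒᵖ) :
    AddSubgroup (∀ x : U.unop, LocAt 𝒜 x.1) where
  carrier := {f | (isLocallyTwistedFraction 𝒜 m).pred f}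
  zero_mem' x := by
    obtain ⟨e, s, he, hs⟩ := exists_homogeneous_notMem 𝒜 m x.1
    refine ⟨U.unop ⊓ ProjectiveSpectrum.basicOpen 𝒜 s.1, ⟨x.2, hs⟩, Opens.infLELeft _ _,
      (e + m).toNat, e, ⟨0, zero_mem _⟩, s, by omega, fun y => ⟨y.2.2, ?_⟩⟩
    exact (Localization.mk_zero _).symm
  add_mem' {a b} ha hb x := by
    obtain ⟨Va, ma, ia, da, ea, ⟨ra, hra⟩, ⟨sa, hsa⟩, ha, wa⟩ := ha x
    obtain ⟨Vb, mb, ib, db, eb, ⟨rb, hrb⟩, ⟨sb, hsb⟩, hb, wb⟩ := hb x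
    have h : eb + da = ea + db := by omega
    refine ⟨Va ⊓ Vb, ⟨ma, mb⟩, Opens.infLELeft _ _ ≫ ia, ea + db, ea + eb,
      ⟨sa * rb + sb * ra, add_mem (SetLike.mul_mem_graded hsa hrb)
        (h ▸ SetLike.mul_mem_graded hsb hra)⟩,
      ⟨sa * sb, SetLike.mul_mem_graded hsa hsb⟩, by push_cast; omega, fun y => ?_⟩
    obtain ⟨ha', wa⟩ := wa ⟨y.1, y.2.1⟩
    obtain ⟨hb', wb⟩ := wb ⟨y.1, y.2.2⟩
    exact ⟨mul_mem ha' hb', (congrArg₂ (· + ·) wa wb).trans (fracAt_add 𝒜 y.1 _ _ _ _ _ _)⟩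
  neg_mem' {a} ha x := by
    obtain ⟨Va, ma, ia, da, ea, ⟨ra, hra⟩, ⟨sa, hsa⟩, ha, wa⟩ := ha x
    refine ⟨Va, ma, ia, da, ea, ⟨-ra, neg_mem hra⟩, ⟨sa, hsa⟩, ha, fun y => ?_⟩
    obtain ⟨h, e⟩ := wa y
    exact ⟨h, (congrArg Neg.neg e).trans (Localization.neg_mk _ _)⟩

/-- `𝒪(m)` as a sheaf of sets. -/
def twistInType : TopCat.Sheaf (Type u) (ProjectiveSpectrum.top 𝒜) :=
  TopCat.subsheafToTypes (isLocallyTwistedFraction 𝒜 m)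

/-- `𝒪(m)` as a presheaf of abelian groups. -/
def twistPresheaf : (Opens (Proj 𝒜))ᵒᵖ ⥤ Ab.{u} where
  obj U := AddCommGrpCat.of (twistSections 𝒜 m U)
  map i := AddCommGrpCat.ofHom
    { toFun := (twistInType 𝒜 m).1.map i
      map_zero' := rfl
      map_add' := fun _ _ => rfl }

/-- A section `g` of the structure sheaf acts on `𝒪(m)` by `(g • f)(𝔭) = g(𝔭) f(𝔭)` in `A_𝔭`. -/
def twistSmul (U : (Opens (ProjectiveSpectrum.top 𝒜))ᵒᵖ)
    (g : (ProjectiveSpectrum.Proj.structureSheaf 𝒜).1.obj U) (f : twistSections 𝒜 m U) :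
    twistSections 𝒜 m U :=
  ⟨fun x => (g.1 x).val * f.1 x, fun x => by
    obtain ⟨Va, ma, ia, d, ⟨ra, hra⟩, ⟨sa, hsa⟩, ha, wa⟩ := g.2 x
    obtain ⟨Vb, mb, ib, db, eb, ⟨rb, hrb⟩, ⟨sb, hsb⟩, hb, wb⟩ := f.2 x
    refine ⟨Va ⊓ Vb, ⟨ma, mb⟩, Opens.infLELeft _ _ ≫ ia, d + db, d + eb,
      ⟨ra * rb, SetLike.mul_mem_graded hra hrb⟩, ⟨sa * sb, SetLike.mul_mem_graded hsa hsb⟩,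
      by push_cast; omega, fun y => ?_⟩
    have wa := wa ⟨y.1, y.2.1⟩
    obtain ⟨hb', wb⟩ := wb ⟨y.1, y.2.2⟩
    refine ⟨mul_mem (ha ⟨y.1, y.2.1⟩) hb', ?_⟩
    exact (congrArg₂ (· * ·) ((congrArg HomogeneousLocalization.val wa).trans
      (HomogeneousLocalization.val_mk _)) wb).trans (fracAt_mul 𝒜 y.1 _ _ _ _ _ _)⟩

instance twistModule (U : (Opens (Proj 𝒜))ᵒᵖ) :
    Module ((Proj 𝒜).ringCatSheaf.obj.obj U) ((twistPresheaf 𝒜 m).obj U) where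
  smul g f := twistSmul 𝒜 m U g f
  one_smul f := Subtype.ext <| funext fun x =>
    (congrArg (· * f.1 x) HomogeneousLocalization.val_one).trans (one_mul _)
  mul_smul _ _ f := Subtype.ext <| funext fun x =>
    (congrArg (· * f.1 x) (HomogeneousLocalization.val_mul _ _)).trans (mul_assoc _ _ _)
  smul_zero _ := Subtype.ext <| funext fun _ => mul_zero _
  smul_add _ _ _ := Subtype.ext <| funext fun _ => mul_add _ _ _
  add_smul _ _ f := Subtype.ext <| funext fun x =>
    (congrArg (· * f.1 x) (HomogeneousLocalization.val_add _ _)).trans (add_mul _ _ _)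
  zero_smul f := Subtype.ext <| funext fun x =>
    (congrArg (· * f.1 x) HomogeneousLocalization.val_zero).trans (zero_mul _)

/-- Serre's twisting sheaf `𝒪(m)` on `Proj 𝒜`, as a sheaf of modules. -/
def twist : (Proj 𝒜).Modules where
  val := PresheafOfModules.ofPresheaf (R := (Proj 𝒜).ringCatSheaf.obj) (twistPresheaf 𝒜 m)
    (fun _ _ _ _ _ => rfl)
  isSheaf := (TopCat.Presheaf.isSheaf_iff_isSheaf_comp (forget AddCommGrpCat) _).2
    (twistInType 𝒜 m).2

end Twist

/-! ### Projective space -/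

section ProjectiveSpace

attribute [local instance] MvPolynomial.gradedAlgebra

/-- The grading of `k[x₀, …, xₙ]` by degree. -/
abbrev polyGrading (n : ℕ) (k : Type u) [Field k] :
    ℕ → Submodule k (MvPolynomial (Fin (n + 1)) k) :=
  MvPolynomial.homogeneousSubmodule (Fin (n + 1)) k

/-- Projective `n`-space `ℙⁿ` over `k`. -/
def projectiveSpace (n : ℕ) (k : Type u) [Field k] : Scheme.{u} :=
  Proj (polyGrading n k)

/-- The structure morphism `ℙⁿ ⟶ Spec k`. -/
def projectiveSpaceToSpec (n : ℕ) (k : Type u) [Field k] :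
    projectiveSpace n k ⟶ Spec (.of k) :=
  Proj.toSpecZero (polyGrading n k) ≫
    Spec.map (CommRingCat.ofHom (algebraMap k (polyGrading n k 0)))

/-- The sheaf `𝒪(m)` on `ℙⁿ`. -/
def serreTwist (n : ℕ) (k : Type u) [Field k] (m : ℤ) : (projectiveSpace n k).Modules :=
  twist (polyGrading n k) m

end ProjectiveSpace

/-! ### Sheaves of modules -/

section Modules

variable {X : Scheme.{u}}

/-- The tensor product of two sheaves of `𝒪_X`-modules: the sheafification of
`U ↦ E(U) ⊗ G(U)`. -/
def tensor (E G : X.Modules) : X.Modules :=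
  (PresheafOfModules.sheafification (𝟙 X.ringCatSheaf.obj)).obj
    (PresheafOfModules.Monoidal.tensorObj (R := X.presheaf) E.val G.val)

/-- A vector bundle: a sheaf of modules that is locally free of finite rank. -/
def IsVectorBundle (E : X.Modules) : Prop :=
  ∀ x : X, ∃ (U : X.Opens) (_ : x ∈ U) (r : ℕ),
    Nonempty (E.restrict U.ι ≅
      (SheafOfModules.free (R := (U : Scheme.{u}).ringCatSheaf) (ULift.{u} (Fin r)) :
        (U : Scheme.{u}).Modules))

/-- The sheaf cohomology group `Hʲ(X, E)`. -/
abbrev cohomology (E : X.Modules) (j : ℕ) : Type u :=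
  Sheaf.H ((SheafOfModules.toSheaf X.ringCatSheaf).obj E) j

/-- For a morphism `i : X ⟶ ℙⁿ`, the twist `E(m) = E ⊗ 𝒪_X(m)` with `𝒪_X(m) = i^* 𝒪(m)`. -/
def twistBy {n : ℕ} {k : Type u} [Field k] (i : X ⟶ projectiveSpace n k) (E : X.Modules)
    (m : ℤ) : X.Modules :=
  tensor E ((Scheme.Modules.pullback i).obj (serreTwist n k m))

/-- `E` is an ACM bundle on `X` with respect to the embedding `i : X ⟶ ℙⁿ`. -/
def IsACM {n : ℕ} {k : Type u} [Field k] (i : X ⟶ projectiveSpace n k) (E : X.Modules) :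
    Prop :=
  IsVectorBundle E ∧
    ∀ (m : ℤ) (j : ℕ), 0 < j → (j : WithBot ℕ∞) < topologicalKrullDim X →
      Subsingleton (cohomology (twistBy i E m) j)

end Modules

/-! ### The absolute Frobenius -/

section Frobenius

/-- The `p`-th power map of a commutative ring in which `p = 0`. -/
def powRingHom {R : Type u} [CommRing R] (p : ℕ) [hp : Fact p.Prime] (h : (p : R) = 0) :
    R →+* R where
  toFun a := a ^ p
  map_one' := one_pow p
  map_mul' a b := mul_pow a b p
  map_zero' := zero_pow hp.out.ne_zero
  map_add' a b := by
    obtain ⟨r, hr⟩ := exists_add_pow_prime_eq hp.out a b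
    simp [hr, h]

lemma natCast_sections_eq_zero {X : Scheme.{u}} {p : ℕ} (h : (p : Γ(X, ⊤)) = 0) (U : X.Opens) :
    (p : Γ(X, U)) = 0 := by
  rw [← map_natCast (X.presheaf.map (homOfLE (le_top : U ≤ ⊤)).op).hom p, h, map_zero]

/-- The absolute Frobenius as a morphism of ringed spaces. -/
def frobeniusPresheafedSpace (X : Scheme.{u}) (p : ℕ) [Fact p.Prime] (h : (p : Γ(X, ⊤)) = 0) :
    X.toPresheafedSpace ⟶ X.toPresheafedSpace where
  base := 𝟙 _
  c :=
    { app := fun U => CommRingCat.ofHom (powRingHom p (natCast_sections_eq_zero h U.unop))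
      naturality := fun U V i => by
        ext a
        exact (map_pow (X.presheaf.map i).hom a p).symm }

/-- The absolute Frobenius `F : X ⟶ X` of a scheme with `p = 0` in `𝒪_X`: the identity on the
underlying space and `a ↦ a ^ p` on sections. -/
def absFrobenius (X : Scheme.{u}) (p : ℕ) [hp : Fact p.Prime] (h : (p : Γ(X, ⊤)) = 0) :
    X ⟶ X where
  toHom := frobeniusPresheafedSpace X p h
  prop x := by
    refine ⟨fun a ha => ?_⟩
    obtain ⟨U, hx, s, rfl⟩ := X.presheaf.exists_germ_eq a
    have h1 := PresheafedSpace.stalkMap_germ_apply (frobeniusPresheafedSpace X p h) U x hx s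
    have h2 := h1 ▸ ha
    have h3 := map_pow (X.presheaf.germ U x hx).hom s p
    exact (isUnit_pow_iff hp.out.ne_zero).mp (h3 ▸ h2)

lemma natCast_eq_zero_of_charP {X : Scheme.{u}} {k : Type u} [Field k] (p : ℕ) [CharP k p]
    (f : X ⟶ Spec (.of k)) : (p : Γ(X, ⊤)) = 0 := by
  have h := map_natCast (((Scheme.ΓSpecIso (.of k)).inv ≫ f.appTop).hom) p
  rw [← h]
  exact (congrArg _ (CharP.cast_eq_zero k p)).trans (map_zero _)

end Frobenius

end PushACM

end

/-!
Smoothness makes `F` finite flat: locally `X` is étale over an affine space, the Frobenius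
`a ↦ a ^ p` of a polynomial ring over `k` is flat, and flatness of the Frobenius descends along the
unramified map from the polynomial ring to the coordinate ring. Hence `F_* 𝒪_X` is a vector bundle,
and the products of a local frame of `E` with one of `F_* 𝒪_X` form a local frame of `F_* E`. The
two frames can be taken over the same open set because `F` is the identity on the space.

Raising sections to the power `p` defines a morphism `𝒪(m) ⟶ F_* 𝒪(pm)` taking the local generators
`f ^ m` to the local generators `f ^ (pm)`, so that `F^* 𝒪_X(m) ≅ 𝒪_X(pm)`. The projection formula
then gives `(F_* E)(m) ≅ F_* (E(pm))`, and the cohomology of the latter is that of `E(pm)`, again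
because `F` is the identity on the space.
-/

noncomputable section

namespace PushACM

section FrobeniusFlat

lemma flat_of_flat_comp_of_formallyUnramified {R S T : Type*} [CommRing R] [CommRing S]
    [CommRing T] {f : R →+* S} {g : S →+* T} (hgf : (g.comp f).Flat) (hf : f.FormallyUnramified)
    (hf' : f.FiniteType) : g.Flat := by
  algebraize [f, g, g.comp f]
  exact Algebra.FormallyUnramified.flat_of_restrictScalars R S T

open Polynomial in
lemma flat_expand {R : Type*} [CommRing R] {p : ℕ} (hp : p ≠ 0) :
    (expand R p : R[X] →+* R[X]).Flat := by
  let q : R[X][X] := X ^ p - C X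
  have hq : q.Monic := monic_X_pow_sub_C X hp
  let e : AdjoinRoot q →+* R[X] := AdjoinRoot.lift (expand R p : R[X] →+* R[X]) X (by simp [q])
  let e' : R[X] →+* AdjoinRoot q := eval₂RingHom ((AdjoinRoot.of q).comp C) (AdjoinRoot.root q)
  have he : Function.Bijective e := by
    refine Function.bijective_iff_has_inverse.mpr ⟨e', fun x ↦ ?_, fun f ↦ ?_⟩
    · have h : AdjoinRoot.root q ^ p = AdjoinRoot.of q X := by
        simpa [q, sub_eq_zero] using AdjoinRoot.eval₂_root q
      have : e'.comp e = RingHom.id _ := by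
        ext <;> simp [e, e', h]
      exact congr($this x)
    · have : e.comp e' = RingHom.id _ := by
        ext <;> simp [e, e']
      exact congr($this f)
  have hof : (AdjoinRoot.of q).Flat := by
    have := hq.free_adjoinRoot
    exact (RingHom.flat_algebraMap_iff (R := R[X]) (S := AdjoinRoot q)).mpr inferInstance
  convert hof.comp (.of_bijective he)
  ext <;> simp [e]

open Polynomial in
attribute [local instance] Polynomial.algebra in
lemma flat_mapRingHom {R S : Type*} [CommRing R] [CommRing S] {φ : R →+* S} (hφ : φ.Flat) :
    (mapRingHom φ).Flat := by
  algebraize [φ]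
  exact RingHom.flat_algebraMap_iff.mpr (Module.Flat.isBaseChange R R[X] S S[X]
    (Algebra.IsPushout.out (R := R) (S := R[X]) (R' := S) (S' := S[X])))

lemma natCast_eq_zero_of_ringHom {R S : Type*} [CommRing R] [CommRing S] (f : R →+* S) {p : ℕ}
    (h : (p : R) = 0) : (p : S) = 0 := by
  rw [← map_natCast f, h, map_zero]

variable {p : ℕ} [hp : Fact p.Prime]

lemma powRingHom_comp {R S : Type u} [CommRing R] [CommRing S] (f : R →+* S) (hR : (p : R) = 0)
    (hS : (p : S) = 0) : (powRingHom p hS).comp f = f.comp (powRingHom p hR) :=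
  RingHom.ext fun a => (map_pow f a p).symm

lemma isIntegral_powRingHom {R : Type u} [CommRing R] (h : (p : R) = 0) :
    (powRingHom p h).IsIntegral := fun a =>
  ⟨Polynomial.X ^ p - Polynomial.C a, Polynomial.monic_X_pow_sub_C a hp.out.ne_zero, by
    simp [powRingHom]⟩

lemma flat_powRingHom_polynomial {R : Type u} [CommRing R] {h : (p : R) = 0}
    (hR : (powRingHom p h).Flat) (h' : (p : Polynomial R) = 0) : (powRingHom p h').Flat := by
  convert (flat_mapRingHom hR).comp (flat_expand hp.out.ne_zero)
  ext <;> simp [powRingHom, ← map_pow]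

lemma flat_powRingHom_of_ringEquiv {R S : Type u} [CommRing R] [CommRing S] (e : R ≃+* S)
    {h : (p : R) = 0} (hR : (powRingHom p h).Flat) (h' : (p : S) = 0) :
    (powRingHom p h').Flat := by
  have he : (powRingHom p h').comp (e : R →+* S) = (e : R →+* S).comp (powRingHom p h) :=
    powRingHom_comp _ h h'
  rw [← RingHom.Flat.comp_iff_of_bijective_right (g := (e : R →+* S)) e.bijective, he]
  exact hR.comp (.of_bijective e.bijective)

lemma flat_powRingHom_mvPolynomial {R : Type u} [CommRing R] {h : (p : R) = 0}
    (hR : (powRingHom p h).Flat) (n : ℕ) (h' : (p : MvPolynomial (Fin n) R) = 0) :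
    (powRingHom p h').Flat := by
  induction n with
  | zero =>
    exact flat_powRingHom_of_ringEquiv (MvPolynomial.isEmptyAlgEquiv R (Fin 0)).symm.toRingEquiv
      hR h'
  | succ n ih =>
    have hn := natCast_eq_zero_of_ringHom (MvPolynomial.C (σ := Fin n) (R := R)) h
    exact flat_powRingHom_of_ringEquiv (MvPolynomial.finSuccEquiv R n).symm.toRingEquiv
      (flat_powRingHom_polynomial (ih hn) (natCast_eq_zero_of_ringHom Polynomial.C hn)) h'

/-- We factor `f` through a polynomial ring over which `S` is étale, hence unramified. -/
lemma flat_powRingHom_of_isStandardSmooth {R S : Type u} [CommRing R] [CommRing S] {f : R →+* S}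
    (hf : f.IsStandardSmooth) {h : (p : R) = 0} (hR : (powRingHom p h).Flat) (h' : (p : S) = 0) :
    (powRingHom p h').Flat := by
  obtain ⟨n, g, -, hg⟩ := hf.exists_etale_mvPolynomial
  obtain ⟨hg_flat, hg_unr, hg_fp⟩ := RingHom.Etale.iff_flat_and_formallyUnramified.mp hg
  have hn := natCast_eq_zero_of_ringHom (MvPolynomial.C (σ := Fin n) (R := R)) h
  refine flat_of_flat_comp_of_formallyUnramified ?_ hg_unr (.of_finitePresentation hg_fp)
  rw [powRingHom_comp g hn]
  exact (flat_powRingHom_mvPolynomial hR n hn).comp hg_flat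

end FrobeniusFlat

section AbsFrobenius

variable {X S : Scheme.{u}} {p : ℕ} [hp : Fact p.Prime]

lemma absFrobenius_appLE_self (h : (p : Γ(X, ⊤)) = 0) (U : X.Opens) :
    (absFrobenius X p h).appLE U U le_rfl =
      CommRingCat.ofHom (powRingHom p (natCast_sections_eq_zero h U)) :=
  (absFrobenius X p h).appLE_eq_app

lemma absFrobenius_comp (f : X ⟶ S) (hX : (p : Γ(X, ⊤)) = 0) (hS : (p : Γ(S, ⊤)) = 0) :
    absFrobenius X p hX ≫ f = f ≫ absFrobenius S p hS := by
  refine Scheme.Hom.ext rfl fun U ↦ ?_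
  ext a
  exact (ConcreteCategory.congr_hom (X.presheaf.map_id _) ((f.app U).hom a ^ p)).trans
    (map_pow (f.app U).hom a p).symm

lemma absFrobenius_Spec {R : CommRingCat.{u}} (h : (p : Γ(Spec R, ⊤)) = 0) (h' : (p : R) = 0) :
    absFrobenius (Spec R) p h = Spec.map (CommRingCat.ofHom (powRingHom p h')) := by
  refine ext_of_isAffine ?_
  ext a
  obtain ⟨b, rfl⟩ := (Scheme.ΓSpecIso R).symm.commRingCatIsoToRingEquiv.surjective a
  change (Scheme.ΓSpecIso R).inv b ^ p =
    ((Scheme.ΓSpecIso R).inv ≫ (Spec.map (CommRingCat.ofHom (powRingHom p h'))).appTop) b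
  rw [← Scheme.ΓSpecIso_inv_naturality]
  exact (map_pow (Scheme.ΓSpecIso R).inv.hom b p).symm

lemma flat_absFrobenius_of_smooth (f : X ⟶ S) [Smooth f] (hX : (p : Γ(X, ⊤)) = 0)
    (hS : (p : Γ(S, ⊤)) = 0) [Flat (absFrobenius S p hS)] : Flat (absFrobenius X p hX) := by
  rw [HasRingHomProperty.iff_exists_appLE (P := @Flat)
    (RingHom.Flat.stableUnderComposition.stableUnderCompositionWithLocalizationAway
      RingHom.Flat.holdsForLocalizationAway).1]
  intro x
  obtain ⟨V, hV, U, hU, hxU, hUV, hstd⟩ := Smooth.exists_isStandardSmooth f x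
  refine ⟨⟨U, hU⟩, ⟨U, hU⟩, hxU, le_rfl, ?_⟩
  have hV : (powRingHom p (natCast_sections_eq_zero hS V)).Flat := by
    simpa only [absFrobenius_appLE_self, CommRingCat.hom_ofHom] using
      (absFrobenius S p hS).flat_appLE hV hV le_rfl
  simpa only [absFrobenius_appLE_self, CommRingCat.hom_ofHom] using
    flat_powRingHom_of_isStandardSmooth hstd hV (natCast_sections_eq_zero hX U)

lemma isIntegralHom_absFrobenius (h : (p : Γ(X, ⊤)) = 0) : IsIntegralHom (absFrobenius X p h) where
  isAffine_preimage _ hU := hU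
  isIntegral_app U _ := isIntegral_powRingHom (natCast_sections_eq_zero h U)

lemma isFinite_absFrobenius_of_locallyOfFiniteType (f : X ⟶ S) [LocallyOfFiniteType f]
    (hX : (p : Γ(X, ⊤)) = 0) (hS : (p : Γ(S, ⊤)) = 0)
    [LocallyOfFiniteType (absFrobenius S p hS)] : IsFinite (absFrobenius X p hX) := by
  have : LocallyOfFiniteType (absFrobenius X p hX ≫ f) := by
    rw [absFrobenius_comp f hX hS]
    infer_instance
  exact (IsFinite.iff_isIntegralHom_and_locallyOfFiniteType _).mpr
    ⟨isIntegralHom_absFrobenius hX, locallyOfFiniteType_of_comp _ f⟩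

variable {k : Type u} [Field k] [CharP k p] (f : X ⟶ Spec (.of k)) (h : (p : Γ(X, ⊤)) = 0)

lemma flat_absFrobenius_of_smooth_over_field [Smooth f] : Flat (absFrobenius X p h) :=
  flat_absFrobenius_of_smooth f h (natCast_eq_zero_of_charP p (𝟙 _))

lemma isFinite_absFrobenius_over_field [LocallyOfFiniteType f] (hk : (frobenius k p).Finite) :
    IsFinite (absFrobenius X p h) := by
  have hk' := natCast_eq_zero_of_charP p (𝟙 (Spec (.of k)))
  have : LocallyOfFiniteType (absFrobenius (Spec (.of k)) p hk') := by
    rw [absFrobenius_Spec hk' (CharP.cast_eq_zero k p)]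
    exact HasRingHomProperty.Spec_iff.mpr (.of_finite hk)
  exact isFinite_absFrobenius_of_locallyOfFiniteType f h hk'

end AbsFrobenius

section LocallyBijective

lemma isLocallyBijective_of_basis {X : TopCat.{u}} {P Q : TopCat.Presheaf Ab.{u} X} (f : P ⟶ Q)
    (h : ∀ (V : Opens X) (x : X), x ∈ V → ∃ W ≤ V, x ∈ W ∧ Function.Bijective (f.app (op W))) :
    Presheaf.IsLocallyInjective (Opens.grothendieckTopology X) f ∧
      Presheaf.IsLocallySurjective (Opens.grothendieckTopology X) f := by
  refine ⟨⟨fun {V} a b hab x hx => ?_⟩, ⟨fun {V} s x hx => ?_⟩⟩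
  · obtain ⟨W, hWV, hxW, hW⟩ := h V.unop x hx
    refine ⟨W, homOfLE hWV, hW.1 ?_, hxW⟩
    rw [NatTrans.naturality_apply, NatTrans.naturality_apply, hab]
  · obtain ⟨W, hWV, hxW, hW⟩ := h V x hx
    exact ⟨W, homOfLE hWV, hW.2 _, hxW⟩

variable {X : Scheme.{u}} {M N : X.Modules} (f : M ⟶ N)

lemma isIso_of_bijective_app_basis
    (h : ∀ (V : X.Opens) (x : X), x ∈ V → ∃ W ≤ V, x ∈ W ∧ Function.Bijective (f.app W)) :
    IsIso f := by
  have : IsIso ((SheafOfModules.toSheaf X.ringCatSheaf).map f) :=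
    Sheaf.isLocallyBijective_iff_isIso _ |>.1 (isLocallyBijective_of_basis f.mapPresheaf h)
  exact isIso_of_reflects_iso (C := SheafOfModules X.ringCatSheaf) f
    (SheafOfModules.toSheaf X.ringCatSheaf)

lemma isIso_iff_bijective_app : IsIso f ↔ ∀ V, Function.Bijective (f.app V) := by
  simp only [Scheme.Modules.Hom.isIso_iff_isIso_app, ConcreteCategory.isIso_iff_bijective]

end LocallyBijective

section Free

open Limits SheafOfModules

variable {X : Scheme.{u}} {I : Type u}

lemma map_app {M N : X.Modules} (f : M ⟶ N) {V W : X.Opens} (j : W ⟶ V) (x : Γ(M, V)) :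
    f.app W (M.presheaf.map j.op x) = N.presheaf.map j.op (f.app V x) :=
  NatTrans.naturality_apply f.mapPresheaf j.op x

lemma map_map (M : X.Modules) {U V W : X.Opens} (i : V ⟶ U) (j : W ⟶ V) (l : W ⟶ U)
    (x : Γ(M, U)) : M.presheaf.map j.op (M.presheaf.map i.op x) = M.presheaf.map l.op x := by
  rw [← CategoryTheory.comp_apply, ← Functor.map_comp]
  rfl

variable (X) in
/-- The structure sheaf as a sheaf of modules over itself. -/
def unitModule : X.Modules := SheafOfModules.unit X.ringCatSheaf

variable (X I) in
/-- The free sheaf of modules on the set `I`. -/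
def freeModule : X.Modules := SheafOfModules.free (R := X.ringCatSheaf) I

/-- The value on the open set `V` of a global section, the latter being encoded as a compatible
family of sections over all open sets. -/
def evalSection {M : X.Modules} (s : SheafOfModules.sections M) (V : X.Opens) : Γ(M, V) :=
  s.val (op V)

lemma bijective_evalSection (M : X.Modules) {V : X.Opens} (hV : V = ⊤) :
    Function.Bijective (evalSection (M := M) · V) := by
  subst hV
  refine ⟨fun s t hst => PresheafOfModules.sections_ext _ _ fun W => ?_, fun x => ?_⟩
  · have h (s : SheafOfModules.sections M) := s.2 (homOfLE le_top : W.unop ⟶ ⊤).op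
    exact (h s).symm.trans ((congrArg _ hst).trans (h t))
  · refine ⟨PresheafOfModules.sectionsMk
      (fun W => M.presheaf.map (homOfLE le_top : W.unop ⟶ ⊤).op x)
      fun V W j => map_map M _ j.unop _ x, ?_⟩
    exact congr($(M.presheaf.map_id _) x)

/-- The `i`-th basis section of a free sheaf of modules over `V`. -/
def freeBasis (i : I) (V : X.Opens) : Γ(freeModule X I, V) :=
  evalSection (M := freeModule X I) (freeSection i) V

lemma ιFree_app (i : I) (V : X.Opens) (a : Γ(X, V)) :
    Scheme.Modules.Hom.app (M := unitModule X) (N := freeModule X I) (ιFree i) V a =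
      a • freeBasis i V := by
  let φ : unitModule X ⟶ freeModule X I := ιFree i
  refine (congrArg (φ.app V) (mul_one a).symm).trans ?_
  exact φ.app_smul a (show Γ(unitModule X, V) from (1 : Γ(X, V)))

lemma bijective_freeBasis [Fintype I] (V : X.Opens) :
    Function.Bijective fun a : I → Γ(X, V) => ∑ i, a i • freeBasis i V := by
  classical
  let b : Bicone fun _ : I => unitModule X :=
    .ofColimitCocone (C := SheafOfModules X.ringCatSheaf) (isColimitFreeCofan I)
  have hb : b.IsBilimit := biconeIsBilimitOfColimitCoconeOfIsColimit
    (C := SheafOfModules X.ringCatSheaf) (isColimitFreeCofan I)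
  have sum_app (x : Γ(freeModule X I, V)) (f : I → (freeModule X I ⟶ freeModule X I)) :
      (∑ i, f i).app V x = ∑ i, (f i).app V x :=
    map_sum ({ toFun := fun g => g.app V x, map_zero' := rfl, map_add' := fun _ _ => rfl } :
      (freeModule X I ⟶ freeModule X I) →+ Γ(freeModule X I, V)) f _
  have hπ (i j : I) (a : Γ(X, V)) :
      (b.π i).app V (a • freeBasis j V) = if j = i then a else (0 : Γ(X, V)) := by
    refine (congrArg ((b.π i).app V) (ιFree_app j V a).symm).trans
      (congr($(b.ι_π j i).app V a).trans ?_)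
    split_ifs with h <;> [subst h; skip] <;> rfl
  refine Function.bijective_iff_has_inverse.2
    ⟨fun x i => (b.π i).app V x, fun a => funext fun i => ?_, fun x => ?_⟩
  · exact (map_sum ((b.π i).app V).hom _ _).trans
      ((Finset.sum_congr rfl fun j _ => hπ i j (a j)).trans (Fintype.sum_ite_eq' i a))
  · calc
      _ = ∑ i, (b.π i ≫ b.ι i).app V x :=
        Finset.sum_congr rfl fun i _ => (ιFree_app i V _).symm
      _ = _ := (sum_app x _).symm.trans congr($(IsBilimit.total hb).app V x)

lemma bijective_app_iff [Fintype I] {M : X.Modules} (f : freeModule X I ⟶ M) (V : X.Opens) :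
    Function.Bijective (f.app V) ↔
      Function.Bijective fun a : I → Γ(X, V) => ∑ i, a i • f.app V (freeBasis i V) := by
  rw [← Function.Bijective.of_comp_iff _ (bijective_freeBasis V)]
  exact iff_of_eq (congrArg _ (funext fun a => by simp))

/-- The morphism from a free sheaf of modules given by a family of global sections. -/
def freeDesc {M : X.Modules} (s : I → SheafOfModules.sections M) : freeModule X I ⟶ M :=
  (SheafOfModules.freeHomEquiv (R := X.ringCatSheaf) M).symm s

lemma freeDesc_app_freeBasis {M : X.Modules} (s : I → SheafOfModules.sections M) (i : I)
    (V : X.Opens) : (freeDesc s).app V (freeBasis i V) = evalSection (s i) V :=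
  congrArg (evalSection (M := M) · V)
    (sectionsMap_freeHomEquiv_symm_freeSection (R := X.ringCatSheaf) (M := M) s i)

end Free

section Frame

variable {X : Scheme.{u}} {I : Type u}

/-- The sections `s i` of `M` over `V` form a frame of `M` over `V`: over each open subset of `V`
their restrictions are a basis of the sections of `M`. -/
def IsFrame {I : Type*} [Fintype I] (M : X.Modules) {V : X.Opens} (s : I → Γ(M, V)) : Prop :=
  ∀ ⦃W : X.Opens⦄ (j : W ⟶ V), Function.Bijective fun a : I → Γ(X, W) =>
    ∑ i, a i • M.presheaf.map j.op (s i)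

variable {M : X.Modules} {V : X.Opens}

lemma IsFrame.restrict {I : Type*} [Fintype I] {s : I → Γ(M, V)} (hs : IsFrame M s)
    {W : X.Opens} (j : W ⟶ V) : IsFrame M fun i => M.presheaf.map j.op (s i) := fun U l => by
  simpa only [map_map M j l (l ≫ j)] using hs (l ≫ j)

lemma exists_ι_image_eq {W : X.Opens} (h : W ≤ V) : ∃ U : (V : Scheme.{u}).Opens, V.ι ''ᵁ U = W :=
  ⟨V.ι ⁻¹ᵁ W, by simpa [Scheme.Hom.image_preimage_eq_opensRange_inf] using h⟩

lemma bijective_restrict_ι_iff [Fintype I] (M : X.Modules) (V : X.Opens)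
    (W : (V : Scheme.{u}).Opens) (s : I → Γ(M, V.ι ''ᵁ W)) :
    (Function.Bijective fun a : I → Γ((V : Scheme.{u}), W) =>
      ∑ i, a i • (show Γ(M.restrict V.ι, W) from s i)) ↔
    Function.Bijective fun a : I → Γ(X, V.ι ''ᵁ W) => ∑ i, a i • s i := by
  refine iff_of_eq (congrArg _ (funext fun a => Finset.sum_congr rfl fun i _ => ?_))
  refine (Scheme.Modules.smul_restrictAppIso_hom_apply V.ι M W (a i) (s i)).trans ?_
  simp [Scheme.Opens.ι_appIso]
  rfl

/-- The global section of `M.restrict V.ι` given by a section of `M` over `V`. -/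
def restrictSection (s : Γ(M, V)) : SheafOfModules.sections (M.restrict V.ι) :=
  PresheafOfModules.sectionsMk
    (fun W => M.presheaf.map (homOfLE (V.ι_image_le W.unop)).op s) fun _ _ j =>
      map_map M _ (homOfLE (V.ι.image_mono j.unop.le)) _ s

lemma surjective_restrictSection : Function.Surjective (restrictSection (M := M) (V := V)) := by
  refine fun t => ⟨M.presheaf.map (homOfLE (by simp) : V ⟶ V.ι ''ᵁ ⊤).op (evalSection t ⊤),
    (bijective_evalSection _ rfl).1 ?_⟩
  exact (map_map M _ _ (𝟙 _) _).trans congr($(M.presheaf.map_id _) _)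

/-- The morphism from a free sheaf of modules on `V` to the restriction of `M` to `V` which is given
by sections of `M` over `V`. -/
def frameHom (s : I → Γ(M, V)) : freeModule (V : Scheme.{u}) I ⟶ M.restrict V.ι :=
  freeDesc fun i => restrictSection (s i)

lemma surjective_frameHom : Function.Surjective (frameHom (M := M) (V := V) (I := I)) :=
  (SheafOfModules.freeHomEquiv (R := (V : Scheme.{u}).ringCatSheaf)
    (M.restrict V.ι)).symm.surjective.comp surjective_restrictSection.comp_left

variable [Fintype I]

lemma bijective_frameHom_app_iff (s : I → Γ(M, V)) (W : (V : Scheme.{u}).Opens) :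
    Function.Bijective ((frameHom s).app W) ↔
      Function.Bijective fun a : I → Γ(X, V.ι ''ᵁ W) =>
        ∑ i, a i • M.presheaf.map (homOfLE (V.ι_image_le W)).op (s i) := by
  rw [bijective_app_iff, ← bijective_restrict_ι_iff]
  simp only [frameHom, freeDesc_app_freeBasis]
  rfl

lemma isFrame_iff_isIso_frameHom (s : I → Γ(M, V)) : IsFrame M s ↔ IsIso (frameHom s) := by
  rw [isIso_iff_bijective_app]
  simp only [bijective_frameHom_app_iff]
  refine ⟨fun h W => h _, fun h W j => ?_⟩
  obtain ⟨W, rfl⟩ := exists_ι_image_eq j.le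
  exact h W

lemma isFrame_of_basis {s : I → Γ(M, V)}
    (h : ∀ U ≤ V, ∀ x ∈ U, ∃ W ≤ U, ∃ j : W ⟶ V, x ∈ W ∧
      Function.Bijective fun a : I → Γ(X, W) => ∑ i, a i • M.presheaf.map j.op (s i)) :
    IsFrame M s := by
  refine (isFrame_iff_isIso_frameHom s).2 (isIso_of_bijective_app_basis _ fun U x hx => ?_)
  obtain ⟨W, hWU, j, hxW, hW⟩ := h (V.ι ''ᵁ U) (V.ι_image_le U) x.1 (V.mem_ι_image_iff.2 hx)
  obtain ⟨W, rfl⟩ := exists_ι_image_eq j.le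
  exact ⟨W, fun y hy => V.mem_ι_image_iff.1 (hWU (V.mem_ι_image_iff.2 hy)),
    V.mem_ι_image_iff.1 hxW, (bijective_frameHom_app_iff s W).2 hW⟩

lemma IsFrame.comp_equiv {I J : Type*} [Fintype I] [Fintype J] {s : I → Γ(M, V)}
    (hs : IsFrame M s) (e : J ≃ I) : IsFrame M (s ∘ e) := fun W j => by
  convert (hs j).comp (Equiv.arrowCongr e (.refl Γ(X, W))).bijective using 2 with a
  simp [← e.sum_comp]

lemma isVectorBundle_iff_exists_isFrame : IsVectorBundle M ↔
    ∀ x : X, ∃ (V : X.Opens) (_ : x ∈ V) (I : Type u) (_ : Fintype I) (s : I → Γ(M, V)),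
      IsFrame M s := by
  refine forall_congr' fun x => ⟨?_, ?_⟩
  · rintro ⟨V, hx, r, ⟨e⟩⟩
    replace e : M.restrict V.ι ≅ freeModule (V : Scheme.{u}) (ULift.{u} (Fin r)) := e
    obtain ⟨s, hs⟩ := surjective_frameHom e.inv
    exact ⟨V, hx, _, inferInstance, s, (isFrame_iff_isIso_frameHom s).2 (hs ▸ inferInstance)⟩
  · rintro ⟨V, hx, I, _, s, hs⟩
    let t := s ∘ Equiv.ulift.{u}.trans (Fintype.equivFin I).symm
    have : IsIso (frameHom t) := (isFrame_iff_isIso_frameHom t).1 (hs.comp_equiv _)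
    exact ⟨V, hx, _, ⟨(asIso (frameHom t)).symm⟩⟩

/-- A morphism to a sheaf extended from `V` is determined by the images of sections over `V`; a
frame is what makes arbitrary images possible. -/
lemma isFrame_iff_bijective_app (s : I → Γ(M, V)) :
    IsFrame M s ↔ ∀ P : (V : Scheme.{u}).Modules, Function.Bijective
      fun (φ : M ⟶ (Scheme.Modules.pushforward V.ι).obj P) i => φ.app V (s i) := by
  rw [isFrame_iff_isIso_frameHom, isIso_iff_coyoneda_map_bijective]
  refine forall_congr' fun P => ?_
  let e : (freeModule (V : Scheme.{u}) I ⟶ P) ≃ (I → SheafOfModules.sections P) :=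
    SheafOfModules.freeHomEquiv P
  have hev := (Function.Bijective.piMap fun _ : I =>
    bijective_evalSection P (V := V.ι ⁻¹ᵁ V) (by simp)).comp e.bijective
  rw [← hev.of_comp_iff', ← Function.Bijective.of_comp_iff _
    ((Scheme.Modules.restrictAdjunction V.ι).homEquiv M P).bijective]
  refine iff_of_eq (congrArg _ (funext fun ψ => funext fun i => ?_))
  exact congrArg (ψ.app _) (freeDesc_app_freeBasis _ i (V.ι ⁻¹ᵁ V))

end Frame

section Pullback

variable {X Y : Scheme.{u}} (f : X ⟶ Y) (M : Y.Modules) {V : Y.Opens}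

/-- The pullback along `f` of a section of `M` over `V`. -/
def pullbackSection (s : Γ(M, V)) : Γ((Scheme.Modules.pullback f).obj M, f ⁻¹ᵁ V) :=
  ((Scheme.Modules.pullbackPushforwardAdjunction f).unit.app M).app V s

lemma homEquiv_app {N : X.Modules} (φ : (Scheme.Modules.pullback f).obj M ⟶ N) (s : Γ(M, V)) :
    ((Scheme.Modules.pullbackPushforwardAdjunction f).homEquiv M N φ).app V s =
      φ.app (f ⁻¹ᵁ V) (pullbackSection f M s) := by
  rw [Adjunction.homEquiv_unit]
  rfl

variable {M} in
lemma IsFrame.pullback {I : Type u} [Fintype I] {s : I → Γ(M, V)} (hs : IsFrame M s) :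
    IsFrame ((Scheme.Modules.pullback f).obj M) fun i => pullbackSection f M (s i) := by
  rw [isFrame_iff_bijective_app] at hs ⊢
  intro P
  let e : (Scheme.Modules.pushforward f).obj ((Scheme.Modules.pushforward (f ⁻¹ᵁ V).ι).obj P) ≅
      (Scheme.Modules.pushforward V.ι).obj ((Scheme.Modules.pushforward (f ∣_ V)).obj P) :=
    (Scheme.Modules.pushforwardComp _ f ≪≫
      Scheme.Modules.pushforwardCongr (morphismRestrict_ι f V).symm ≪≫
      (Scheme.Modules.pushforwardComp _ V.ι).symm).app P
  have he : Function.Bijective (e.hom.app V) := (isIso_iff_bijective_app _).1 inferInstance V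
  refine ((Function.Bijective.piMap fun _ : I => he).of_comp_iff' _).1 ?_
  convert (hs _).comp (((Scheme.Modules.pullbackPushforwardAdjunction f).homEquiv M _).trans
    e.homToEquiv).bijective using 1
  ext φ i
  exact congrArg (e.hom.app V) (homEquiv_app f M φ (s i)).symm

end Pullback

section FiniteFlat

lemma free_of_isLocalizedModule {A M : Type*} [CommRing A] [AddCommGroup M] [Module A M]
    (S : Submonoid A) [Module.Free (Localization S) (LocalizedModule S M)]
    (A' : Type*) [CommRing A'] [Algebra A A'] [IsLocalization S A'] {M' : Type*}
    [AddCommGroup M'] [Module A M'] [Module A' M'] [IsScalarTower A A' M'] (f : M →ₗ[A] M')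
    [IsLocalizedModule S f] : Module.Free A' M' := by
  let e := IsLocalization.algEquiv S (Localization S) A'
  let : Module (Localization S) M' := .compHom M' e.toRingEquiv.toRingHom
  have : IsScalarTower A (Localization S) M' := .of_algebraMap_smul fun a x => by
    change e (algebraMap _ _ a) • x = _
    rw [e.commutes, algebraMap_smul]
  let l := (IsLocalizedModule.iso S f).extendScalarsOfIsLocalization S (Localization S)
  have := RingHomInvPair.of_ringEquiv e.toRingEquiv
  have := RingHomInvPair.symm (e.toRingEquiv : Localization S →+* A') (e.toRingEquiv.symm)
  exact .of_equiv (σ := (e.toRingEquiv : Localization S →+* A')) { l with map_smul' := l.map_smul }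

lemma bijective_sum_mul_of_isLocalization {A B A' B' : Type*} [CommRing A] [CommRing B]
    [CommRing A'] [CommRing B'] [Algebra A A'] [Algebra B B'] (φ : A →+* B) (φ' : A' →+* B')
    (h : φ'.comp (algebraMap A A') = (algebraMap B B').comp φ) (r : A)
    [IsLocalization.Away r A'] [IsLocalization.Away (φ r) B'] {I : Type*} [Fintype I] {b : I → B}
    (hb : Function.Bijective fun a : I → A => ∑ i, φ (a i) * b i) :
    Function.Bijective fun a : I → A' => ∑ i, φ' (a i) * algebraMap B B' (b i) := by
  algebraize [φ, φ', (algebraMap B B').comp φ]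
  have : IsScalarTower A A' B' := .of_algebraMap_eq' h.symm
  have : IsLocalization (Algebra.algebraMapSubmonoid B (.powers r)) B' := by
    rwa [Algebra.algebraMapSubmonoid_powers]
  let e : (I → A) ≃ₗ[A] B := .ofBijective (Fintype.linearCombination A b) hb
  let b' := (Module.Basis.ofEquivFun e.symm).localizationLocalization A' (.powers r) B'
  convert b'.equivFun.symm.bijective using 2 with a
  rw [Module.Basis.equivFun_symm_apply]
  refine Finset.sum_congr rfl fun i _ => ?_
  have hbi : Module.Basis.ofEquivFun e.symm i = b i := by
    classical
    rw [Module.Basis.coe_ofEquivFun, LinearEquiv.symm_symm]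
    exact (Fintype.linearCombination_apply_single A b i 1).trans (one_smul A _)
  rw [Module.Basis.localizationLocalization_apply, hbi, Algebra.smul_def,
    RingHom.algebraMap_toAlgebra φ']

lemma exists_bijective_sum_mul_of_flat {A B : Type u} [CommRing A] [CommRing B] {φ : A →+* B}
    (hfin : φ.Finite) (hfp : φ.FinitePresentation) (hflat : φ.Flat) (q : Ideal A) [q.IsPrime] :
    ∃ r ∉ q, ∀ (A' B' : Type u) [CommRing A'] [CommRing B'] [Algebra A A'] [Algebra B B']
      (φ' : A' →+* B') (_ : φ'.comp (algebraMap A A') = (algebraMap B B').comp φ)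
      [IsLocalization.Away r A'] [IsLocalization.Away (φ r) B'],
      ∃ (I : Type u) (_ : Fintype I) (b : I → B'),
        Function.Bijective fun a : I → A' => ∑ i, φ' (a i) * b i := by
  algebraize [φ]
  have : Module.FinitePresentation A B := .of_finite_of_finitePresentation A B
  have : Module.Free (Localization.AtPrime q) (LocalizedModule.AtPrime q B) :=
    Module.free_of_flat_of_isLocalRing
  obtain ⟨r, hr, hfree, -⟩ := Module.FinitePresentation.exists_free_localizedModule_powers
    q.primeCompl (LocalizedModule.mkLinearMap q.primeCompl B) (Localization.AtPrime q)
  refine ⟨r, hr, ?_⟩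
  intro A' B' _ _ _ _ φ' h _ _
  algebraize [φ', (algebraMap B B').comp φ]
  have : IsScalarTower A A' B' := .of_algebraMap_eq' h.symm
  have : IsLocalization (Algebra.algebraMapSubmonoid B (.powers r)) B' := by
    rwa [Algebra.algebraMapSubmonoid_powers]
  have : Module.Free A' B' := free_of_isLocalizedModule (.powers r) A'
    (IsScalarTower.toAlgHom A B B').toLinearMap
  have : Module.Finite A' B' := .of_isLocalizedModule (.powers r)
    (IsScalarTower.toAlgHom A B B').toLinearMap
  let b := Module.Free.chooseBasis A' B'
  refine ⟨_, inferInstance, b, ?_⟩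
  convert b.equivFun.symm.bijective using 2 with a
  simp only [Module.Basis.equivFun_symm_apply, Algebra.smul_def, RingHom.algebraMap_toAlgebra φ']

variable {X Y : Scheme.{u}} (f : X ⟶ Y)

lemma isFrame_pushforward_unitModule_of_isAffineOpen [IsAffineHom f] {V : Y.Opens}
    (hV : IsAffineOpen V) {I : Type u} [Fintype I] {b : I → Γ(X, f ⁻¹ᵁ V)}
    (hb : Function.Bijective fun a : I → Γ(Y, V) => ∑ i, f.app V (a i) * b i) :
    IsFrame ((Scheme.Modules.pushforward f).obj (unitModule X)) (V := V) b := by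
  refine isFrame_of_basis fun U hUV x hx => ?_
  obtain ⟨r, hr, hxr⟩ := hV.exists_basicOpen_le ⟨x, hx⟩ (hUV hx)
  let j := homOfLE (Y.basicOpen_le r)
  refine ⟨_, hr, j, hxr, ?_⟩
  let l := (Opens.map f.base).map j
  let := (Y.presheaf.map j.op).hom.toAlgebra
  let := (X.presheaf.map l.op).hom.toAlgebra
  have := hV.isLocalization_of_eq_basicOpen r j rfl
  have := (hV.preimage f).isLocalization_of_eq_basicOpen (f.app V r) l
    (Scheme.preimage_basicOpen f r)
  exact bijective_sum_mul_of_isLocalization (f.app V).hom (f.app (Y.basicOpen r)).hom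
    congr($(f.naturality j.op).hom) r hb

lemma isVectorBundle_pushforward_unitModule [IsFinite f] [Flat f]
    [LocallyOfFinitePresentation f] :
    IsVectorBundle ((Scheme.Modules.pushforward f).obj (unitModule X)) := by
  refine isVectorBundle_iff_exists_isFrame.2 fun y => ?_
  obtain ⟨V, hV, hy, -⟩ := exists_isAffineOpen_mem_and_subset (U := ⊤) (x := y) trivial
  have happ : f.app V = f.appLE V (f ⁻¹ᵁ V) le_rfl := f.app_eq_appLE
  obtain ⟨r, hr, h⟩ := exists_bijective_sum_mul_of_flat (f.finite_app V hV)
    (happ ▸ f.finitePresentation_appLE hV (hV.preimage f) le_rfl)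
    (happ ▸ f.flat_appLE hV (hV.preimage f) le_rfl)
    ((IsLocalRing.maximalIdeal (Y.presheaf.stalk y)).comap (Y.presheaf.germ V y hy).hom)
  let j := homOfLE (Y.basicOpen_le r)
  let l := (Opens.map f.base).map j
  let := (Y.presheaf.map j.op).hom.toAlgebra
  let := (X.presheaf.map l.op).hom.toAlgebra
  have := hV.isLocalization_of_eq_basicOpen r j rfl
  have := (hV.preimage f).isLocalization_of_eq_basicOpen (f.app V r) l
    (Scheme.preimage_basicOpen f r)
  obtain ⟨I, _, b, hb⟩ := h Γ(Y, Y.basicOpen r) Γ(X, f ⁻¹ᵁ Y.basicOpen r)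
    (f.app (Y.basicOpen r)).hom congr($(f.naturality j.op).hom)
  have hyr : y ∈ Y.basicOpen r := (Y.mem_basicOpen r y hy).2 (by simpa using hr)
  exact ⟨_, hyr, I, inferInstance, b,
    isFrame_pushforward_unitModule_of_isAffineOpen f (hV.basicOpen r) hb⟩

variable {f} in
lemma IsFrame.pushforward {E : X.Modules} {V : Y.Opens} {I J : Type*} [Fintype I] [Fintype J]
    {b : J → Γ(X, f ⁻¹ᵁ V)}
    (hb : IsFrame ((Scheme.Modules.pushforward f).obj (unitModule X)) (V := V) b)
    {s : I → Γ(E, f ⁻¹ᵁ V)} (hs : IsFrame E s) :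
    IsFrame ((Scheme.Modules.pushforward f).obj E) (V := V) fun z : J × I => b z.1 • s z.2 := by
  intro W j
  let l := (Opens.map f.base).map j
  let c : (J × I → Γ(Y, W)) ≃ (I → J → Γ(Y, W)) := (Equiv.curry _ _ _).trans (Equiv.piComm _)
  refine (congrArg Function.Bijective (funext fun a => ?_)).mp
    ((hs l).comp ((Function.Bijective.piMap fun _ => hb j).comp c.bijective))
  refine Eq.trans ?_ (Fintype.sum_prod_type_right _).symm
  refine Finset.sum_congr rfl fun i _ =>
    (Finset.sum_smul (R := Γ(X, f ⁻¹ᵁ W)) (M := Γ(E, f ⁻¹ᵁ W))).trans ?_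
  refine Finset.sum_congr rfl fun i' _ => ?_
  refine (mul_smul (α := Γ(X, f ⁻¹ᵁ W)) (β := Γ(E, f ⁻¹ᵁ W)) _ _ _).trans ?_
  exact congrArg (f.app W (a (i', i)) • · : Γ(E, f ⁻¹ᵁ W) → _) (E.map_smul l (b i') (s i)).symm

variable {f} in
lemma IsVectorBundle.pushforward (hf : IsHomeomorph f)
    (h : IsVectorBundle ((Scheme.Modules.pushforward f).obj (unitModule X))) {E : X.Modules}
    (hE : IsVectorBundle E) : IsVectorBundle ((Scheme.Modules.pushforward f).obj E) := by
  rw [isVectorBundle_iff_exists_isFrame] at h hE ⊢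
  intro y
  obtain ⟨x, rfl⟩ := hf.surjective y
  obtain ⟨U, hx, I, _, s, hs⟩ := hE x
  obtain ⟨V, hy, J, _, b, hb⟩ := h (f x)
  let U' : Y.Opens := ⟨f '' U, hf.isOpenMap _ U.isOpen⟩
  have hU' : f ⁻¹ᵁ U' = U := Opens.ext (Set.preimage_image_eq _ hf.injective)
  let l : f ⁻¹ᵁ (V ⊓ U') ⟶ U := homOfLE (hU' ▸ fun z hz => hz.2)
  exact ⟨V ⊓ U', ⟨hy, x, hx, rfl⟩, _, inferInstance, _,
    (hb.restrict (homOfLE inf_le_left)).pushforward (hs.restrict l)⟩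

end FiniteFlat

section Tensor

open TensorProduct

variable {X : Scheme.{u}} {E G P : X.Modules} {V W : X.Opens}

variable (E G) in
/-- The morphism from the presheaf `V ↦ E(V) ⊗ G(V)` to its sheafification `tensor E G`. -/
def toTensor : PresheafOfModules.Monoidal.tensorObj (R := X.presheaf) E.val G.val ⟶
    (PresheafOfModules.restrictScalars (𝟙 X.ringCatSheaf.obj)).obj (tensor E G).val :=
  PresheafOfModules.sheafificationHomEquiv _ (𝟙 (tensor E G))

/-- The section `x ⊗ s` of `tensor E G`. -/
def tmul (V : X.Opens) : Γ(E, V) →ₗ[Γ(X, V)] Γ(G, V) →ₗ[Γ(X, V)] Γ(tensor E G, V) :=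
  TensorProduct.curry ((toTensor E G).app (op V)).hom

lemma map_tmul (j : W ⟶ V) (x : Γ(E, V)) (s : Γ(G, V)) :
    (tensor E G).presheaf.map j.op (tmul V x s) =
      tmul W (E.presheaf.map j.op x) (G.presheaf.map j.op s) :=
  (congr($((toTensor E G).naturality j.op) (x ⊗ₜ s))).symm

/-- The morphism of sheaves of modules given by compatible bilinear maps on sections. -/
def tensorLift (β : ∀ V, Γ(E, V) →ₗ[Γ(X, V)] Γ(G, V) →ₗ[Γ(X, V)] Γ(P, V))
    (hβ : ∀ ⦃V W⦄ (j : W ⟶ V) (x s), P.presheaf.map j.op (β V x s) =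
      β W (E.presheaf.map j.op x) (G.presheaf.map j.op s)) : tensor E G ⟶ P :=
  (PresheafOfModules.sheafificationHomEquiv (𝟙 X.ringCatSheaf.obj)).symm
    { app V := ModuleCat.MonoidalCategory.tensorLift (fun x s => β V.unop x s)
        (fun x y s => (β V.unop).map_add₂ x y s) (fun a x s => (β V.unop).map_smul₂ a x s)
        (fun x => (β V.unop x).map_add) (fun a x => (β V.unop x).map_smul a)
      naturality {_ _} j := ModuleCat.MonoidalCategory.tensor_ext fun x s =>
        (hβ j.unop x s).symm }

lemma tensorLift_app_tmul (β : ∀ V, Γ(E, V) →ₗ[Γ(X, V)] Γ(G, V) →ₗ[Γ(X, V)] Γ(P, V))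
    (hβ) (x : Γ(E, V)) (s : Γ(G, V)) : (tensorLift β hβ).app V (tmul V x s) = β V x s := by
  let e : (tensor E G ⟶ P) ≃ _ := PresheafOfModules.sheafificationHomEquiv (𝟙 X.ringCatSheaf.obj)
  have h : e (tensorLift β hβ) = _ := e.apply_symm_apply _
  exact congr(($h).app (op V) (show Γ(E, V) ⊗[Γ(X, V)] Γ(G, V) from x ⊗ₜ s))

/-- The section `s` of `M` over `V` generates `M` freely over `V`. -/
def IsGenerator (M : X.Modules) (s : Γ(M, V)) : Prop := IsFrame M fun _ : PUnit.{u + 1} => s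

lemma isGenerator_iff {s : Γ(G, V)} : IsGenerator G s ↔
    ∀ ⦃W⦄ (j : W ⟶ V), Function.Bijective fun a : Γ(X, W) => a • G.presheaf.map j.op s := by
  refine forall₂_congr fun W j => ?_
  rw [← Function.Bijective.of_comp_iff _ (Equiv.funUnique PUnit Γ(X, W)).symm.bijective]
  exact iff_of_eq (congrArg _ (funext fun a =>
    Fintype.sum_unique fun _ : PUnit.{u + 1} => a • G.presheaf.map j.op s))

lemma bijective_tmul_of_bijective_smul {R M N : Type*} [CommRing R] [AddCommGroup M] [Module R M]
    [AddCommGroup N] [Module R N] {s : N} (hs : Function.Bijective fun a : R => a • s) :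
    Function.Bijective fun x : M => x ⊗ₜ[R] s := by
  let e : R ≃ₗ[R] N := LinearEquiv.ofBijective (LinearMap.toSpanSingleton R N s) hs
  convert ((TensorProduct.rid R M).symm.trans (TensorProduct.congr (.refl R M) e)).bijective using 1
  ext x
  exact congrArg (x ⊗ₜ[R] ·) (one_smul R s).symm

lemma exists_map_eq_of_toTensor_app_eq {z w : Γ(E, V) ⊗[Γ(X, V)] Γ(G, V)}
    (h : (toTensor E G).app (op V) z = (toTensor E G).app (op V) w) {x : X} (hx : x ∈ V) :
    ∃ (W : X.Opens) (j : W ⟶ V), x ∈ W ∧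
      (PresheafOfModules.Monoidal.tensorObj (R := X.presheaf) E.val G.val).map j.op z =
      (PresheafOfModules.Monoidal.tensorObj (R := X.presheaf) E.val G.val).map j.op w := by
  obtain ⟨W, j, hj, hxW⟩ := Presheaf.equalizerSieve_mem (Opens.grothendieckTopology X)
    (toSheafify (Opens.grothendieckTopology X)
      (PresheafOfModules.Monoidal.tensorObj (R := X.presheaf) E.val G.val).presheaf) z w h x hx
  exact ⟨W, j, hxW, hj⟩

lemma exists_toTensor_app_eq (t : Γ(tensor E G, V)) {x : X} (hx : x ∈ V) :
    ∃ (W : X.Opens) (j : W ⟶ V) (z : Γ(E, W) ⊗[Γ(X, W)] Γ(G, W)), x ∈ W ∧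
      (toTensor E G).app (op W) z = (tensor E G).presheaf.map j.op t := by
  obtain ⟨W, j, ⟨z, hz⟩, hxW⟩ := Presheaf.imageSieve_mem (Opens.grothendieckTopology X)
    (toSheafify (Opens.grothendieckTopology X)
      (PresheafOfModules.Monoidal.tensorObj (R := X.presheaf) E.val G.val).presheaf) t x hx
  exact ⟨W, j, z, hxW, hz⟩

variable (E) in
/-- Multiplication by a section `s` of `G` over `V`, as a morphism of sheaves of abelian groups on
`V`. -/
def tmulRight (s : Γ(G, V)) :
    (SheafOfModules.toSheaf _).obj (E.restrict V.ι) ⟶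
      (SheafOfModules.toSheaf _).obj ((tensor E G).restrict V.ι) where
  hom :=
    { app W := AddCommGrpCat.ofHom ((tmul (E := E) (V.ι ''ᵁ W.unop)).flip
        (G.presheaf.map (homOfLE (V.ι_image_le W.unop)).op s)).toAddMonoidHom
      naturality W W' j := by
        ext x
        let l : V.ι ''ᵁ W'.unop ⟶ V.ι ''ᵁ W.unop := homOfLE (V.ι.image_mono j.unop.le)
        exact ((map_tmul l x _).trans (congrArg (tmul (V.ι ''ᵁ W'.unop) (E.presheaf.map l.op x))
          (map_map G _ l _ s))).symm }

lemma IsGenerator.isIso_tmulRight {s : Γ(G, V)} (hs : IsGenerator G s) :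
    IsIso (tmulRight E s) := by
  have hs' (W : (V : Scheme.{u}).Opens) := bijective_tmul_of_bijective_smul (M := Γ(E, V.ι ''ᵁ W))
    (isGenerator_iff.1 hs (homOfLE (V.ι_image_le W)))
  refine (Sheaf.isLocallyBijective_iff_isIso _).1
    ⟨⟨fun {W} x y hxy z hz => ?_⟩, ⟨fun {W} t z hz => ?_⟩⟩
  · obtain ⟨U, j, hzU, h⟩ := exists_map_eq_of_toTensor_app_eq hxy (V.mem_ι_image_iff.2 hz)
    obtain ⟨U, rfl⟩ := exists_ι_image_eq (j.le.trans (V.ι_image_le _))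
    refine ⟨U, homOfLE ((V.ι.image_le_image_iff _ _).1 j.le), (hs' U).1 ?_, V.mem_ι_image_iff.1 hzU⟩
    rw [← map_map G (homOfLE (V.ι_image_le W.unop)) j _ s]
    exact h
  · obtain ⟨U, j, x, hzU, h⟩ := exists_toTensor_app_eq t (V.mem_ι_image_iff.2 hz)
    obtain ⟨U, rfl⟩ := exists_ι_image_eq (j.le.trans (V.ι_image_le _))
    obtain ⟨e, rfl⟩ := (hs' U).2 x
    exact ⟨U, homOfLE ((V.ι.image_le_image_iff _ _).1 j.le), ⟨e, h⟩, V.mem_ι_image_iff.1 hzU⟩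

lemma IsGenerator.bijective_tmul {s : Γ(G, V)} (hs : IsGenerator G s) (j : W ⟶ V) :
    Function.Bijective fun x : Γ(E, W) => tmul W x (G.presheaf.map j.op s) := by
  obtain ⟨W, rfl⟩ := exists_ι_image_eq j.le
  have := hs.isIso_tmulRight (E := E)
  have : IsIso ((tmulRight E s).hom.app (op W)) := inferInstance
  exact (ConcreteCategory.isIso_iff_bijective _).1 this

end Tensor

section ProjectionFormula

variable {X Y : Scheme.{u}} (f : X ⟶ Y)

/-- The morphism `φ : L ⟶ f_* G` maps local generators of `L` to generators of `G`; equivalently,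
`L` is invertible and `φ` identifies `f^* L` with `G`. -/
def PreservesLocalGenerators {L : Y.Modules} {G : X.Modules}
    (φ : L ⟶ (Scheme.Modules.pushforward f).obj G) : Prop :=
  ∀ y : Y, ∃ (V : Y.Opens) (_ : y ∈ V) (s : Γ(L, V)),
    IsGenerator L s ∧ IsGenerator (V := f ⁻¹ᵁ V) G (φ.app V s)

variable {L : Y.Modules} {G : X.Modules} (φ : L ⟶ (Scheme.Modules.pushforward f).obj G)
  (E : X.Modules)

/-- The morphism `x ⊗ s ↦ x ⊗ φ(s)` of the projection formula. -/
def projectionHom : tensor ((Scheme.Modules.pushforward f).obj E) L ⟶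
    (Scheme.Modules.pushforward f).obj (tensor E G) :=
  tensorLift
    (fun V => LinearMap.mk₂ Γ(Y, V) (fun x s => tmul (E := E) (G := G) (f ⁻¹ᵁ V) x (φ.app V s))
      (fun x y s => (tmul (f ⁻¹ᵁ V)).map_add₂ (show Γ(E, f ⁻¹ᵁ V) from x) y _)
      (fun a x s => (tmul (f ⁻¹ᵁ V)).map_smul₂ (f.app V a) (show Γ(E, f ⁻¹ᵁ V) from x) _)
      (fun x s t => (congrArg (tmul (f ⁻¹ᵁ V) x) (map_add (φ.app V).hom s t)).trans
        ((tmul (f ⁻¹ᵁ V) (show Γ(E, f ⁻¹ᵁ V) from x)).map_add (φ.app V s) (φ.app V t)))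
      (fun a x s => (congrArg (tmul (f ⁻¹ᵁ V) x) (φ.app_smul a s)).trans
        ((tmul (f ⁻¹ᵁ V) (show Γ(E, f ⁻¹ᵁ V) from x)).map_smul (f.app V a) (φ.app V s))))
    fun V W j x s => by
      refine (map_tmul ((Opens.map f.base).map j) x (φ.app V s)).trans ?_
      exact congrArg (tmul (f ⁻¹ᵁ W) _) (map_app φ j s).symm

variable {f φ}

lemma PreservesLocalGenerators.isIso_projectionHom (hφ : PreservesLocalGenerators f φ) :
    IsIso (projectionHom f φ E) := by
  refine isIso_of_bijective_app_basis _ fun V y hy => ?_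
  obtain ⟨U, hyU, s, hs, hs'⟩ := hφ y
  let j : V ⊓ U ⟶ U := homOfLE inf_le_right
  refine ⟨V ⊓ U, inf_le_left, ⟨hy, hyU⟩, ?_⟩
  rw [← Function.Bijective.of_comp_iff _ (hs.bijective_tmul j)]
  refine (congrArg Function.Bijective (funext fun x => ?_)).mp
    (hs'.bijective_tmul (E := E) ((Opens.map f.base).map j))
  symm
  refine (tensorLift_app_tmul _ _ _ _).trans ?_
  exact congrArg (tmul (f ⁻¹ᵁ (V ⊓ U)) x) (map_app φ j s)

end ProjectionFormula

section BaseChange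

variable {X X' Y Y' : Scheme.{u}} {f : Y' ⟶ Y} {f' : X' ⟶ X} {i : X ⟶ Y} {i' : X' ⟶ Y'}
  (h : i' ≫ f = f' ≫ i) {L : Y.Modules} {G : Y'.Modules}
  (φ : L ⟶ (Scheme.Modules.pushforward f).obj G)

/-- The base change `i^* L ⟶ f'_* (i'^* G)` of a morphism `L ⟶ f_* G` along a commutative square. -/
def baseChangeHom : (Scheme.Modules.pullback i).obj L ⟶
    (Scheme.Modules.pushforward f').obj ((Scheme.Modules.pullback i').obj G) :=
  ((Scheme.Modules.pullbackPushforwardAdjunction i).homEquiv _ _).symm <|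
    φ ≫ (Scheme.Modules.pushforward f).map
      ((Scheme.Modules.pullbackPushforwardAdjunction i').unit.app G) ≫
    (Scheme.Modules.pushforwardComp i' f ≪≫ Scheme.Modules.pushforwardCongr h ≪≫
      (Scheme.Modules.pushforwardComp f' i).symm).hom.app ((Scheme.Modules.pullback i').obj G)

lemma baseChangeHom_app_pullbackSection {V : Y.Opens} (s : Γ(L, V)) :
    (baseChangeHom h φ).app (i ⁻¹ᵁ V) (pullbackSection i L s) =
      ((Scheme.Modules.pullback i').obj G).presheaf.map
        (eqToHom (congrArg (fun g : X' ⟶ Y => g ⁻¹ᵁ V) h.symm)).op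
        (pullbackSection i' G (φ.app V s)) := by
  refine (homEquiv_app i L (baseChangeHom h φ) s).symm.trans ?_
  rw [baseChangeHom, Equiv.apply_symm_apply]
  rfl

variable {φ}

lemma PreservesLocalGenerators.baseChangeHom (hφ : PreservesLocalGenerators f φ) :
    PreservesLocalGenerators f' (baseChangeHom h φ) := by
  intro x
  obtain ⟨V, hx, s, hs, hs'⟩ := hφ (i x)
  refine ⟨i ⁻¹ᵁ V, hx, pullbackSection i L s, hs.pullback i, ?_⟩
  rw [baseChangeHom_app_pullbackSection]
  exact (hs'.pullback i').restrict _

end BaseChange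

section TwistSections

variable {A σ : Type u} [CommRing A] [SetLike σ A] [AddSubgroupClass σ A]
  {𝒜 : ℕ → σ} [GradedRing 𝒜] {m : ℤ} {W : (Proj 𝒜).Opens}

/-- The value in `A_𝔭` of a section of `𝒪(m)`. -/
def twistVal (s : Γ(twist 𝒜 m, W)) (x : W) : LocAt 𝒜 x.1 :=
  (show twistSections 𝒜 m (op W) from s).1 x

lemma twistVal_ext {s t : Γ(twist 𝒜 m, W)} (h : ∀ x, twistVal s x = twistVal t x) : s = t :=
  Subtype.ext (funext h)

lemma isLocallyTwistedFraction_twistVal (s : Γ(twist 𝒜 m, W)) :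
    (isLocallyTwistedFraction 𝒜 m).pred (twistVal s) :=
  (show twistSections 𝒜 m (op W) from s).2

/-- The section of `𝒪(m)` with prescribed values. -/
def twistMk (φ : ∀ x : W, LocAt 𝒜 x.1) (hφ : (isLocallyTwistedFraction 𝒜 m).pred φ) :
    Γ(twist 𝒜 m, W) :=
  (⟨φ, hφ⟩ : twistSections 𝒜 m (op W))

/-- The value in `A_𝔭` of a section of the structure sheaf. -/
def structVal (a : Γ(Proj 𝒜, W)) (x : W) : LocAt 𝒜 x.1 :=
  ((show (ProjectiveSpectrum.Proj.structureSheaf 𝒜).1.obj (op W) from a).1 x).val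

lemma structVal_ext {a b : Γ(Proj 𝒜, W)} (h : ∀ x, structVal a x = structVal b x) : a = b :=
  Subtype.ext (funext fun x => HomogeneousLocalization.val_injective _ (h x))

lemma structVal_pow (a : Γ(Proj 𝒜, W)) (n : ℕ) (x : W) :
    structVal (a ^ n) x = structVal a x ^ n :=
  HomogeneousLocalization.val_pow _ _

lemma val_mk_eq_fracAt {d : ℕ} (x : ProjectiveSpectrum 𝒜) (r t : 𝒜 d) (ht) :
    (HomogeneousLocalization.mk ⟨d, r, t, ht⟩ : HomogeneousLocalization.AtPrime 𝒜
      x.asHomogeneousIdeal.toIdeal).val = fracAt 𝒜 x r t ht :=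
  HomogeneousLocalization.val_mk _

lemma exists_structVal_eq {φ : ∀ x : W, LocAt 𝒜 x.1}
    (hφ : (isLocallyTwistedFraction 𝒜 0).pred φ) : ∃ a : Γ(Proj 𝒜, W), structVal a = φ := by
  have hval (x : W) : ∃ y : HomogeneousLocalization.AtPrime 𝒜
      (show ProjectiveSpectrum 𝒜 from x.1).asHomogeneousIdeal.toIdeal,
      y.val = φ x := by
    obtain ⟨V, hxV, j, d, e, r, t, hde, w⟩ := hφ x
    obtain rfl : d = e := by omega
    obtain ⟨ht, hx⟩ := w ⟨x.1, hxV⟩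
    exact ⟨_, (val_mk_eq_fracAt x.1 r t ht).trans hx.symm⟩
  choose c hc using hval
  refine ⟨(⟨c, fun x => ?_⟩ : (ProjectiveSpectrum.Proj.structureSheaf 𝒜).1.obj (op W)), funext hc⟩
  obtain ⟨V, hxV, j, d, e, r, t, hde, w⟩ := hφ x
  obtain rfl : d = e := by omega
  choose ht hφt using w
  refine ⟨V, hxV, j, d, r, t, ht, fun y => HomogeneousLocalization.val_injective _ ?_⟩
  exact (hc _).trans ((hφt y).trans (val_mk_eq_fracAt y.1 r t (ht y)).symm)

lemma isLocallyTwistedFraction_mul {m' : ℤ} {φ ψ : ∀ x : W, LocAt 𝒜 x.1}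
    (hφ : (isLocallyTwistedFraction 𝒜 m).pred φ) (hψ : (isLocallyTwistedFraction 𝒜 m').pred ψ) :
    (isLocallyTwistedFraction 𝒜 (m + m')).pred (φ * ψ) := by
  intro x
  obtain ⟨V, hxV, i, d, e, r, t, hde, w⟩ := hφ x
  obtain ⟨V', hxV', i', d', e', r', t', hde', w'⟩ := hψ x
  refine ⟨V ⊓ V', ⟨hxV, hxV'⟩, Opens.infLELeft _ _ ≫ i, d + d', e + e',
    ⟨r * r', SetLike.mul_mem_graded r.2 r'.2⟩, ⟨t * t', SetLike.mul_mem_graded t.2 t'.2⟩,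
    by push_cast; omega, fun y => ?_⟩
  obtain ⟨ht, hy⟩ := w ⟨y.1, y.2.1⟩
  obtain ⟨ht', hy'⟩ := w' ⟨y.1, y.2.2⟩
  exact ⟨mul_mem ht ht', (congrArg₂ (· * ·) hy hy').trans (fracAt_mul 𝒜 y.1 _ _ _ _ _ _)⟩

lemma fracAt_pow (x : ProjectiveSpectrum 𝒜) (a b : A) (hb) (n : ℕ) :
    fracAt 𝒜 x a b hb ^ n = fracAt 𝒜 x (a ^ n) (b ^ n) (Submonoid.pow_mem _ hb n) :=
  Localization.mk_pow n a _

lemma fracAt_mul_swap (x : ProjectiveSpectrum 𝒜) (a b : A) (ha hb) :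
    fracAt 𝒜 x a b hb * fracAt 𝒜 x b a ha = 1 := by
  rw [fracAt_mul, fracAt, Localization.mk_eq_mk', IsLocalization.mk'_eq_iff_eq_mul, one_mul,
    mul_comm]

lemma isLocallyTwistedFraction_pow (p : ℕ) {φ : ∀ x : W, LocAt 𝒜 x.1}
    (hφ : (isLocallyTwistedFraction 𝒜 m).pred φ) :
    (isLocallyTwistedFraction 𝒜 (p * m)).pred (φ ^ p) := by
  intro x
  obtain ⟨V, hxV, i, d, e, r, t, hde, w⟩ := hφ x
  refine ⟨V, hxV, i, p * d, p * e, ⟨r ^ p, SetLike.pow_mem_graded p r.2⟩,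
    ⟨t ^ p, SetLike.pow_mem_graded p t.2⟩, by push_cast; rw [hde]; ring, fun y => ?_⟩
  obtain ⟨ht, hy⟩ := w y
  exact ⟨Submonoid.pow_mem _ ht p, (congrArg (· ^ p) hy).trans (fracAt_pow y.1 r t ht p)⟩

variable {f : A}

variable (m) in
/-- The section `f ^ m` of `𝒪(m)` over the basic open set of an element `f` of degree one, written
`f ^ max(m, 0) / f ^ max(-m, 0)`. -/
def twistGen (hf : f ∈ 𝒜 1) : Γ(twist 𝒜 m, Proj.basicOpen 𝒜 f) :=
  have hpow (n : ℕ) : f ^ n ∈ 𝒜 n := by simpa using SetLike.pow_mem_graded n hf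
  twistMk (fun x => fracAt 𝒜 x.1 (f ^ m.toNat) (f ^ (-m).toNat) (Submonoid.pow_mem _ x.2 _))
    fun x => ⟨_, x.2, 𝟙 _, m.toNat, (-m).toNat, ⟨_, hpow _⟩, ⟨_, hpow _⟩, by omega,
      fun y => ⟨Submonoid.pow_mem _ y.2 _, rfl⟩⟩

lemma twistVal_twistGen_mul_neg (hf : f ∈ 𝒜 1) (x : Proj.basicOpen 𝒜 f) :
    twistVal (twistGen m hf) x * twistVal (twistGen (-m) hf) x = 1 := by
  refine Eq.trans ?_ (fracAt_mul_swap x.1 (f ^ m.toNat) (f ^ (-m).toNat)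
    (Submonoid.pow_mem _ x.2 _) (Submonoid.pow_mem _ x.2 _))
  simp only [twistGen, neg_neg]
  rfl

lemma isUnit_twistVal_map_twistGen (hf : f ∈ 𝒜 1) (i : W ⟶ Proj.basicOpen 𝒜 f)
    (x : W) : IsUnit (twistVal ((twist 𝒜 m).presheaf.map i.op (twistGen m hf)) x) :=
  .of_mul_eq_one _ (twistVal_twistGen_mul_neg hf ⟨x.1, i.le x.2⟩)

lemma isGenerator_twistGen (hf : f ∈ 𝒜 1) : IsGenerator (twist 𝒜 m) (twistGen m hf) := by
  refine isGenerator_iff.2 fun W i => ⟨fun a b hab => structVal_ext fun x => ?_, fun s => ?_⟩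
  · exact (isUnit_twistVal_map_twistGen hf i x).mul_right_cancel (congrArg (twistVal · x) hab)
  · have hdeg : (isLocallyTwistedFraction 𝒜 0).pred fun x : W =>
        twistVal s x * twistVal (twistGen (-m) hf) ⟨x, i.le x.2⟩ := by
      rw [← add_neg_cancel m]
      exact isLocallyTwistedFraction_mul (isLocallyTwistedFraction_twistVal s)
        (isLocallyTwistedFraction_twistVal ((twist 𝒜 (-m)).presheaf.map i.op (twistGen (-m) hf)))
    obtain ⟨a, ha⟩ := exists_structVal_eq hdeg
    refine ⟨a, twistVal_ext fun x => ?_⟩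
    refine (congrArg (· * twistVal (twistGen m hf) ⟨x, i.le x.2⟩) (congrFun ha x)).trans ?_
    rw [mul_assoc, mul_comm (twistVal (twistGen (-m) hf) _), twistVal_twistGen_mul_neg, mul_one]

end TwistSections

section TwistPower

variable {A σ : Type u} [CommRing A] [SetLike σ A] [AddSubgroupClass σ A]
  {𝒜 : ℕ → σ} [GradedRing 𝒜] {p : ℕ} [Fact p.Prime]

/-- The `p`-th power map `𝒪(m) ⟶ F_* 𝒪(pm)`. -/
def twistPowHom (hA : (p : A) = 0) (h : (p : Γ(Proj 𝒜, ⊤)) = 0) (m : ℤ) :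
    twist 𝒜 m ⟶ (Scheme.Modules.pushforward (absFrobenius (Proj 𝒜) p h)).obj (twist 𝒜 (p * m)) where
  val :=
    { app W := ModuleCat.ofHom (X := (twist 𝒜 m).val.obj W)
        (Y := ((Scheme.Modules.pushforward (absFrobenius (Proj 𝒜) p h)).obj
          (twist 𝒜 (p * m))).val.obj W)
        { toFun s := twistMk (twistVal s ^ p)
            (isLocallyTwistedFraction_pow p (isLocallyTwistedFraction_twistVal s))
          map_add' s t := twistVal_ext (𝒜 := 𝒜) fun x =>
            (powRingHom p (natCast_eq_zero_of_ringHom (algebraMap A (LocAt 𝒜 x.1)) hA)).map_add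
              (twistVal s x) (twistVal t x)
          map_smul' a s := twistVal_ext (𝒜 := 𝒜) fun x =>
            (mul_pow (structVal a x) (twistVal s x) p).trans
              (congrArg (· * twistVal s x ^ p) (structVal_pow a p x).symm) }
      naturality _ := rfl }

variable {f : A} {m : ℤ}

lemma twistPowHom_app_twistGen (hA : (p : A) = 0) (h : (p : Γ(Proj 𝒜, ⊤)) = 0) (hf : f ∈ 𝒜 1) :
    (twistPowHom hA h m).app (Proj.basicOpen 𝒜 f) (twistGen m hf) =
      twistGen (p * m) hf := by
  have htoNat (n : ℤ) : n.toNat * p = (p * n).toNat := by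
    rcases le_total 0 n with hn | hn
    · rw [Int.toNat_mul p.cast_nonneg hn, Int.toNat_natCast, mul_comm]
    · rw [Int.toNat_of_nonpos hn, zero_mul,
        Int.toNat_of_nonpos (mul_nonpos_of_nonneg_of_nonpos p.cast_nonneg hn)]
  refine twistVal_ext fun x => (fracAt_pow x.1 _ _ _ p).trans ?_
  simp only [← pow_mul, htoNat, mul_neg]
  rfl

lemma preservesLocalGenerators_twistPowHom (hA : (p : A) = 0) (h : (p : Γ(Proj 𝒜, ⊤)) = 0)
    (h𝒜 : ∀ x : Proj 𝒜, ∃ f ∈ 𝒜 1, x ∈ Proj.basicOpen 𝒜 f) :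
    PreservesLocalGenerators (absFrobenius (Proj 𝒜) p h) (twistPowHom hA h m) := by
  intro x
  obtain ⟨f, hf, hx⟩ := h𝒜 x
  refine ⟨_, hx, twistGen m hf, isGenerator_twistGen hf, ?_⟩
  rw [twistPowHom_app_twistGen]
  exact isGenerator_twistGen hf

end TwistPower

section ProjectiveSpace

attribute [local instance] MvPolynomial.gradedAlgebra

variable {n : ℕ} {k : Type u} [Field k]

lemma exists_mem_basicOpen_X (x : projectiveSpace n k) :
    ∃ j : Fin (n + 1), x ∈ Proj.basicOpen (polyGrading n k) (MvPolynomial.X j) := by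
  have hspan : Algebra.adjoin (polyGrading n k 0)
      (Set.range (MvPolynomial.X : Fin (n + 1) → MvPolynomial (Fin (n + 1)) k)) = ⊤ := by
    refine top_le_iff.1 fun f _ => ?_
    induction f using MvPolynomial.induction_on with
    | C a =>
      exact Subalgebra.algebraMap_mem (Algebra.adjoin (polyGrading n k 0) _)
        ⟨MvPolynomial.C a, MvPolynomial.isHomogeneous_C _ a⟩
    | add f g hf hg => exact add_mem (hf trivial) (hg trivial)
    | mul_X f j hf => exact mul_mem (hf trivial) (Algebra.subset_adjoin (Set.mem_range_self j))
  exact Opens.mem_iSup.1 ((Proj.iSup_basicOpen_eq_top' (polyGrading n k) _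
    (fun j => ⟨1, MvPolynomial.isHomogeneous_X k j⟩) hspan).ge (Opens.mem_top x))

variable {p : ℕ} [Fact p.Prime] [CharP k p] (h : (p : Γ(projectiveSpace n k, ⊤)) = 0) (m : ℤ)

/-- The `p`-th power map `𝒪(m) ⟶ F_* 𝒪(pm)` on projective space. -/
def serreTwistPowHom : serreTwist n k m ⟶
    (Scheme.Modules.pushforward (absFrobenius _ p h)).obj (serreTwist n k (p * m)) :=
  twistPowHom (natCast_eq_zero_of_ringHom MvPolynomial.C (CharP.cast_eq_zero k p)) h m

lemma preservesLocalGenerators_serreTwistPowHom :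
    PreservesLocalGenerators (absFrobenius _ p h) (serreTwistPowHom h m) :=
  preservesLocalGenerators_twistPowHom _ h fun x =>
    (exists_mem_basicOpen_X x).imp' _ fun j hj => ⟨MvPolynomial.isHomogeneous_X k j, hj⟩

end ProjectiveSpace

section ACM

lemma subsingleton_H_of_iso {C : Type*} [Category* C] {J : GrothendieckTopology C}
    [HasSheafify J AddCommGrpCat.{u}] [HasExt.{u} (Sheaf J AddCommGrpCat.{u})]
    {F G : Sheaf J AddCommGrpCat.{u}} (e : F ≅ G) {j : ℕ} (h : Subsingleton (Sheaf.H G j)) :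
    Subsingleton (Sheaf.H F j) :=
  let φ : Sheaf.H F j ≃+ Sheaf.H G j := ((Sheaf.functorH J j).mapIso e).addCommGroupIsoToAddEquiv
  φ.toEquiv.subsingleton_congr.2 h

variable {X : Scheme.{u}} {n : ℕ} {k : Type u} [Field k] {p : ℕ} [Fact p.Prime] [CharP k p]
  (i : X ⟶ projectiveSpace n k) (h : (p : Γ(X, ⊤)) = 0)

/-- The `p`-th power map `𝒪_X(m) ⟶ F_* 𝒪_X(pm)`. -/
def pullbackTwistPowHom (m : ℤ) : (Scheme.Modules.pullback i).obj (serreTwist n k m) ⟶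
    (Scheme.Modules.pushforward (absFrobenius X p h)).obj
      ((Scheme.Modules.pullback i).obj (serreTwist n k (p * m))) :=
  have hP := natCast_eq_zero_of_charP p (projectiveSpaceToSpec n k)
  baseChangeHom (absFrobenius_comp i h hP).symm (serreTwistPowHom hP m)

lemma preservesLocalGenerators_pullbackTwistPowHom (m : ℤ) :
    PreservesLocalGenerators (absFrobenius X p h) (pullbackTwistPowHom i h m) :=
  (preservesLocalGenerators_serreTwistPowHom _ m).baseChangeHom _

/-- The projection formula isomorphism `(F_* E)(m) ≅ F_* (E(pm))`. -/
def twistByPushforwardIso (E : X.Modules) (m : ℤ) :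
    twistBy i ((Scheme.Modules.pushforward (absFrobenius X p h)).obj E) m ≅
      (Scheme.Modules.pushforward (absFrobenius X p h)).obj (twistBy i E (p * m)) :=
  have := (preservesLocalGenerators_pullbackTwistPowHom i h m).isIso_projectionHom E
  (asIso (projectionHom _ (pullbackTwistPowHom i h m) E) :)

variable {i} {E : X.Modules}

lemma IsACM.pushforward_absFrobenius (hE : IsACM i E)
    (hF : IsVectorBundle ((Scheme.Modules.pushforward (absFrobenius X p h)).obj E)) :
    IsACM i ((Scheme.Modules.pushforward (absFrobenius X p h)).obj E) := by
  refine ⟨hF, fun m j hj hjX => ?_⟩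
  exact subsingleton_H_of_iso
    ((SheafOfModules.toSheaf X.ringCatSheaf).mapIso (twistByPushforwardIso i h E m))
    (hE.2 (p * m) j hj hjX)

lemma IsVectorBundle.pushforward_absFrobenius (f : X ⟶ Spec (.of k)) [Smooth f]
    (hk : (frobenius k p).Finite) (hE : IsVectorBundle E) :
    IsVectorBundle ((Scheme.Modules.pushforward (absFrobenius X p h)).obj E) := by
  have := LocallyOfFiniteType.isLocallyNoetherian f
  have := flat_absFrobenius_of_smooth_over_field f h
  have := isFinite_absFrobenius_over_field f h hk
  exact .pushforward .id (isVectorBundle_pushforward_unitModule (absFrobenius X p h)) hE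

end ACM

end PushACM

end

theorem mainTheorem9_general {k : Type u} [Field k] (p : ℕ) [Fact p.Prime] [CharP k p]
    (hk : (frobenius k p).Finite) {n : ℕ} {X : Scheme.{u}} (i : X ⟶ PushACM.projectiveSpace n k)
    [Smooth (i ≫ PushACM.projectiveSpaceToSpec n k)] {E : X.Modules} (hE : PushACM.IsACM i E) :
    PushACM.IsACM i
      ((Scheme.Modules.pushforward
        (PushACM.absFrobenius X p
          (PushACM.natCast_eq_zero_of_charP p (i ≫ PushACM.projectiveSpaceToSpec n k)))).obj E) :=
  hE.pushforward_absFrobenius _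
    (hE.1.pushforward_absFrobenius _ (i ≫ PushACM.projectiveSpaceToSpec n k) hk)

theorem mainTheorem9 {k : Type u} [Field k] [IsAlgClosed k] (p : ℕ) [Fact p.Prime] [CharP k p]
    (n : ℕ) (X : Scheme.{u}) [IsIntegral X] (i : X ⟶ PushACM.projectiveSpace n k)
    [IsClosedImmersion i] [Smooth (i ≫ PushACM.projectiveSpaceToSpec n k)]
    (E : X.Modules) (hE : PushACM.IsACM i E) :
    PushACM.IsACM i
      ((Scheme.Modules.pushforward
        (PushACM.absFrobenius X p
          (PushACM.natCast_eq_zero_of_charP p (i ≫ PushACM.projectiveSpaceToSpec n k)))).obj E) :=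
  mainTheorem9_general p (.of_surjective _ (surjective_frobenius k p)) i hE
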